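/- **Theorem (Gaussian isoperimetry).** Let $d \ge 0$ be an integer, let $\mu$ be the standard Gaussian measure $\mathcal N(0, I_d)$ on $\mathbb R^d$, and let $u, u'$ be independent random vectors in $\mathbb R^d$, each with law $\mu$. Let $0 \le \rho \le 1$. Then for every measurable set $A \subseteq \mathbb R^d$ and every real $\tau > 0$, $$\Pr_u\Bigl[\,\Pr_{u'}\bigl[\rho u + \sqrt{1-\rho^2}\,u' \in A\bigr] \le \tau\,\Bigr] \;\le\; \frac{\tau^{1-\rho}}{\mu(A)},$$ where $\Pr_{u'}$ is the probability over $u'$ with $u$ held fixed, $\Pr_u$ is the probability over $u$, and the right-hand side is read as $+\infty$ when $\mu(A) = 0$. -/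

import Mathlib

open MeasureTheory ProbabilityTheory

/-! The engine is Borell's two-function reverse hypercontractive inequality: for `ρ`-correlated
standard Gaussians `X`, `Y` and `p = 1 - ρ`, `(E f^p)^(1/p) * (E g^p)^(1/p) ≤ E[f(X) g(Y)]` for all
measurable `f, g ≥ 0`. Take `f = 1_B` and `g = 1_A`, with `B` the set of `x` from which the noise
lands in `A` with probability at most `τ`. The right side is at most `τ`, so `(μ(B) μ(A))^(1/p) ≤
τ`, which is the claim (`ReverseHypercontractive.measure_mul_measure_le`).

In dimension one the inequality is proved by transport. Let `S`, `T` push the Gaussian monotonically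
onto the laws with densities proportional to `f^p φ`, `g^p φ` on `(-R, R)`. Changing variables in
`E[f(X) g(Y)]` and using `log S' ≤ S' - 1` bounds it below by the product of truncated norms times
`E[exp N(X, Y)]`, where `N` is explicit in the displacements `s = S - id`, `t = T - id` and their
derivatives. Since `exp N ≥ 1 + N`, it suffices that `E N ≥ 0`. By Gaussian integration by parts the
linear terms cancel, leaving a nonnegative multiple of `E(s(X) + t(Y))^2`
(`integrable_integral_nonneg_of_stein`).

Limits remove truncation, continuity and boundedness; the inequality then tensorizes, which gives
all dimensions. -/

/-! ### Monotone transport on the line. -/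

/-- `S` is `F⁻¹ ∘ G`. With `F` and `G` the cumulative functions of two measures of equal mass, this
is the monotone transport map. -/
theorem exists_hasDerivAt_of_antideriv {F G h G' : ℝ → ℝ} {R : ℝ}
    (hF : ∀ x, HasDerivAt F (h x) x) (hpos : ∀ x, 0 < h x)
    (hG : ∀ x, HasDerivAt G (G' x) x) (hGR : ∀ x, G x ∈ Set.Ioo (F (-R)) (F R)) :
    ∃ S : ℝ → ℝ, (∀ w, HasDerivAt S (G' w / h (S w)) w) ∧ (∀ w, F (S w) = G w) ∧
      ∀ w, S w ∈ Set.Ioo (-R) R := by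
  have hmono : StrictMono F := strictMono_of_hasDerivAt_pos hF hpos
  have hcont : Continuous F := continuous_iff_continuousAt.2 fun x => (hF x).continuousAt
  have hord : (Set.range F).OrdConnected := (isPreconnected_range hcont).ordConnected
  have hemb := hmono.isEmbedding_of_ordConnected hord
  have hex : ∀ w, ∃ y, F y = G w := by
    intro w
    have := hord.out (Set.mem_range_self (-R)) (Set.mem_range_self R)
      ⟨(hGR w).1.le, (hGR w).2.le⟩
    exact this
  choose S hS using hex
  have hSc : Continuous S := by
    rw [hemb.continuous_iff]
    have : F ∘ S = G := funext hS
    rw [this]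
    exact continuous_iff_continuousAt.2 fun x => (hG x).continuousAt
  have hmem : ∀ w, S w ∈ Set.Ioo (-R) R := fun w =>
    ⟨hmono.lt_iff_lt.1 (by rw [hS]; exact (hGR w).1),
      hmono.lt_iff_lt.1 (by rw [hS]; exact (hGR w).2)⟩
  refine ⟨S, fun w => ?_, hS, hmem⟩
  have hopen : IsOpen (Set.range F) := by
    rw [isOpen_iff_mem_nhds]
    rintro _ ⟨y, rfl⟩
    refine Filter.mem_of_superset
      (Ioo_mem_nhds (hmono (sub_one_lt y)) (hmono (lt_add_one y))) fun z hz => ?_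
    exact hord.out (Set.mem_range_self _) (Set.mem_range_self _) ⟨hz.1.le, hz.2.le⟩
  have hoe : Topology.IsOpenEmbedding F := ⟨hemb, hopen⟩
  have hsymm : ∀ w, (hoe.toOpenPartialHomeomorph F).symm (G w) = S w := fun w => by
    rw [← hS w, hoe.toOpenPartialHomeomorph_left_inv]
  have h1 : HasDerivAt (hoe.toOpenPartialHomeomorph F).symm (h (S w))⁻¹ (G w) := by
    refine OpenPartialHomeomorph.hasDerivAt_symm _ ?_ (hpos _).ne' ?_
    · rw [hoe.toOpenPartialHomeomorph_target]
      exact ⟨S w, hS w⟩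
    · rw [hsymm]
      exact hF _
  have h2 := h1.comp w (hG w)
  have h3 : (hoe.toOpenPartialHomeomorph F).symm ∘ G = S := funext hsymm
  rw [h3] at h2
  rwa [div_eq_inv_mul]

theorem gaussianPDFReal_std (x : ℝ) :
    gaussianPDFReal 0 1 x = (√(2 * Real.pi))⁻¹ * Real.exp (-x ^ 2 / 2) := by
  simp [gaussianPDFReal]

theorem continuous_gaussianPDFReal_std : Continuous (gaussianPDFReal 0 1) := by
  have : gaussianPDFReal 0 1 = fun x => (√(2 * Real.pi))⁻¹ * Real.exp (-x ^ 2 / 2) :=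
    funext gaussianPDFReal_std
  rw [this]
  fun_prop

theorem hasDerivAt_gaussianPDFReal_std (x : ℝ) :
    HasDerivAt (gaussianPDFReal 0 1) (-(x * gaussianPDFReal 0 1 x)) x := by
  have : gaussianPDFReal 0 1 = fun x => (√(2 * Real.pi))⁻¹ * Real.exp (-x ^ 2 / 2) :=
    funext gaussianPDFReal_std
  rw [this]
  have h := (((hasDerivAt_id x).pow 2).neg.div_const 2).exp.const_mul (√(2 * Real.pi))⁻¹
  refine h.congr_deriv ?_
  simp
  ring

theorem exists_gaussian_cdf : ∃ Φ : ℝ → ℝ, (∀ x, HasDerivAt Φ (gaussianPDFReal 0 1 x) x) ∧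
    ∀ x, Φ x ∈ Set.Ioo (0 : ℝ) 1 := by
  have hint := integrable_gaussianPDFReal 0 1
  have hd : ∀ x, HasDerivAt (fun x => ∫ t in Set.Iic x, gaussianPDFReal 0 1 t)
      (gaussianPDFReal 0 1 x) x := by
    intro x
    have h1 : HasDerivAt (fun y => (∫ t in Set.Iic (0 : ℝ), gaussianPDFReal 0 1 t) +
        ∫ t in (0 : ℝ)..y, gaussianPDFReal 0 1 t) (gaussianPDFReal 0 1 x) x :=
      (intervalIntegral.integral_hasDerivAt_right hint.intervalIntegrable
        (continuous_gaussianPDFReal_std.stronglyMeasurableAtFilter _ _)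
        continuous_gaussianPDFReal_std.continuousAt).const_add _
    refine h1.congr_of_eventuallyEq (Filter.Eventually.of_forall fun y => ?_)
    simp only
    rw [← intervalIntegral.integral_Iic_sub_Iic hint.integrableOn hint.integrableOn]
    ring
  have hm := strictMono_of_hasDerivAt_pos hd fun x => gaussianPDFReal_pos 0 1 x one_ne_zero
  refine ⟨_, hd, fun x => ⟨?_, ?_⟩⟩
  · exact (setIntegral_nonneg measurableSet_Iic fun t _ => gaussianPDFReal_nonneg 0 1 t).trans_lt
      (hm (sub_one_lt x))
  · refine (hm (lt_add_one x)).trans_le ?_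
    rw [← integral_gaussianPDFReal_eq_one 0 (one_ne_zero : (1 : NNReal) ≠ 0)]
    exact setIntegral_le_integral hint
      (Filter.Eventually.of_forall fun t => gaussianPDFReal_nonneg 0 1 t)

theorem gaussianPDFReal_std_le (x : ℝ) :
    gaussianPDFReal 0 1 x ≤ gaussianPDFReal 0 1 0 := by
  rw [gaussianPDFReal_std, gaussianPDFReal_std]
  refine mul_le_mul_of_nonneg_left (Real.exp_le_exp.2 ?_) (by positivity)
  nlinarith [sq_nonneg x]

/-- Monotone transport of the standard Gaussian to a measure with density proportional to
`f ^ p * φ` on `(-R, R)`. -/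
theorem exists_gaussian_transport {f : ℝ → ℝ} (hf : Continuous f) (hf0 : ∀ x, 0 < f x)
    {p R : ℝ} (hp0 : 0 < p) (hp1 : p ≤ 1) (hR : 0 < R) :
    ∃ S S' : ℝ → ℝ, ∃ B : ℝ, (∀ w, HasDerivAt S (S' w) w) ∧ Function.Injective S ∧
      Continuous S' ∧ (∀ w, |S w| ≤ R) ∧ (∀ w, 0 < S' w) ∧ (∀ w, S' w ≤ B) ∧
      ∀ w, (∫ x in -R..R, f x ^ p * gaussianPDFReal 0 1 x) ^ (1 / p) *
        Real.exp (-(1 / p - 1) * (S' w - 1) + (S w ^ 2 - w ^ 2) / (2 * p)) ≤ f (S w) * S' w := by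
  obtain ⟨Φ, hΦ, hΦ01⟩ := exists_gaussian_cdf
  set h : ℝ → ℝ := fun x => f x ^ p * gaussianPDFReal 0 1 x with hh
  have hφpos : ∀ x, 0 < gaussianPDFReal 0 1 x := fun x => gaussianPDFReal_pos 0 1 x one_ne_zero
  have hhc : Continuous h :=
    (hf.rpow_const fun x => Or.inl (hf0 x).ne').mul continuous_gaussianPDFReal_std
  have hhpos : ∀ x, 0 < h x := fun x => mul_pos (Real.rpow_pos_of_pos (hf0 x) _) (hφpos x)
  set Z := ∫ x in -R..R, h x with hZ
  have hZpos : 0 < Z := intervalIntegral.intervalIntegral_pos_of_pos (hhc.intervalIntegrable _ _)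
    hhpos (by linarith)
  set F : ℝ → ℝ := fun y => ∫ x in -R..y, h x with hFdef
  have hF : ∀ y, HasDerivAt F (h y) y := fun y =>
    intervalIntegral.integral_hasDerivAt_right (hhc.intervalIntegrable _ _)
      (hhc.stronglyMeasurableAtFilter _ _) hhc.continuousAt
  have hF0 : F (-R) = 0 := by simp [hFdef]
  obtain ⟨S, hS, -, hSR⟩ := exists_hasDerivAt_of_antideriv (G := fun w => Z * Φ w)
    (G' := fun w => Z * gaussianPDFReal 0 1 w) (R := R) hF hhpos (fun w => (hΦ w).const_mul Z)
    (fun w => by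
      rw [hF0]
      exact ⟨mul_pos hZpos (hΦ01 w).1, mul_lt_of_lt_one_right hZpos (hΦ01 w).2⟩)
  have hSc : Continuous S := continuous_iff_continuousAt.2 fun x => (hS x).continuousAt
  have hS'pos : ∀ w, 0 < Z * gaussianPDFReal 0 1 w / h (S w) := fun w =>
    div_pos (mul_pos hZpos (hφpos w)) (hhpos _)
  -- Truncation to `[-R, R]` pays off here: `h` has a positive minimum there, so `S'` is bounded, as
  -- integration by parts will require.
  obtain ⟨x₀, -, hx₀⟩ := isCompact_Icc.exists_isMinOn
    (Set.nonempty_Icc.2 (by linarith : -R ≤ R)) hhc.continuousOn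
  refine ⟨S, fun w => Z * gaussianPDFReal 0 1 w / h (S w), Z * gaussianPDFReal 0 1 0 / h x₀, hS,
    (strictMono_of_hasDerivAt_pos hS hS'pos).injective, ?_, ?_, hS'pos, ?_, ?_⟩
  · exact (continuous_const.mul continuous_gaussianPDFReal_std).div (hhc.comp hSc)
      fun w => (hhpos _).ne'
  · exact fun w => abs_le.2 ⟨(hSR w).1.le, (hSR w).2.le⟩
  · intro w
    exact div_le_div₀ (mul_pos hZpos (hφpos 0)).le
      (mul_le_mul_of_nonneg_left (gaussianPDFReal_std_le w) hZpos.le) (hhpos _)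
      (hx₀ ⟨(hSR w).1.le, (hSR w).2.le⟩)
  · intro w
    set D := Z * gaussianPDFReal 0 1 w / h (S w) with hD
    have hDpos : 0 < D := hS'pos w
    have hfS := hf0 (S w)
    have e1 : Real.log D = Real.log Z - w ^ 2 / 2 - p * Real.log (f (S w)) + (S w) ^ 2 / 2 := by
      have : D = Z * Real.exp (-w ^ 2 / 2) / (f (S w) ^ p * Real.exp (-(S w) ^ 2 / 2)) := by
        rw [hD, hh]
        simp only [gaussianPDFReal_std]
        have : (√(2 * Real.pi))⁻¹ ≠ 0 := by positivity
        field_simp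
      rw [this, Real.log_div (by positivity) (by positivity), Real.log_mul (by positivity)
        (by positivity), Real.log_mul (by positivity) (by positivity), Real.log_exp, Real.log_exp,
        Real.log_rpow hfS]
      ring
    -- The only loss in this bound; it makes the exponent linear in `S'`, so that its expectation
    -- can be computed.
    have e2 : Real.log D ≤ D - 1 := Real.log_le_sub_one_of_pos hDpos
    rw [Real.rpow_def_of_pos hZpos, ← Real.exp_add, ← Real.log_le_log_iff (Real.exp_pos _)
      (by positivity), Real.log_exp, Real.log_mul hfS.ne' hDpos.ne']
    have e3 : Real.log (f (S w)) = (1 / p) * (Real.log Z - Real.log D) +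
        (S w ^ 2 - w ^ 2) / (2 * p) := by
      rw [e1]; field_simp; ring
    rw [e3]
    have hk : 0 ≤ 1 / p - 1 := by
      rw [sub_nonneg, le_div_iff₀ hp0]; linarith
    nlinarith [mul_le_mul_of_nonneg_left e2 hk]

/-! ### Gaussian integration by parts for correlated pairs. -/

/-- Integration by parts for the standard Gaussian. -/
theorem integral_mul_gaussianReal_of_bounded {S S' : ℝ → ℝ} {R B : ℝ}
    (hS : ∀ w, HasDerivAt S (S' w) w) (hS'c : Continuous S') (hSR : ∀ w, |S w| ≤ R)
    (hS'B : ∀ w, |S' w| ≤ B) :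
    ∫ x, x * S x ∂gaussianReal 0 1 = ∫ x, S' x ∂gaussianReal 0 1 := by
  have hSc : Continuous S := continuous_iff_continuousAt.2 fun x => (hS x).continuousAt
  have hφ := integrable_gaussianPDFReal 0 1
  have hxφ : Integrable fun x => x * gaussianPDFReal 0 1 x := by
    have h1 : Integrable (fun x : ℝ => x) (gaussianReal 0 1) :=
      (memLp_id_gaussianReal 1).integrable le_rfl
    rw [gaussianReal_of_var_ne_zero _ one_ne_zero, gaussianPDF_def,
      integrable_withDensity_iff (by fun_prop) (by simp)] at h1
    simpa [ENNReal.toReal_ofReal, gaussianPDFReal_nonneg] using h1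
  rw [integral_gaussianReal_eq_integral_smul one_ne_zero,
    integral_gaussianReal_eq_integral_smul one_ne_zero]
  have h := integral_mul_deriv_eq_deriv_mul_of_integrable (u := S) (v := gaussianPDFReal 0 1)
    (u' := S') (v' := fun x => -(x * gaussianPDFReal 0 1 x)) (fun x _ => hS x)
    (fun x _ => hasDerivAt_gaussianPDFReal_std x)
    (hxφ.neg.bdd_mul hSc.aestronglyMeasurable (Filter.Eventually.of_forall hSR))
    (hφ.bdd_mul hS'c.aestronglyMeasurable (Filter.Eventually.of_forall hS'B))
    (hφ.bdd_mul hSc.aestronglyMeasurable (Filter.Eventually.of_forall hSR))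
  have e1 : ∀ x, gaussianPDFReal 0 1 x • (x * S x) = -(S x * -(x * gaussianPDFReal 0 1 x)) := by
    intro x; simp only [smul_eq_mul]; ring
  have e2 : ∀ x, gaussianPDFReal 0 1 x • S' x = S' x * gaussianPDFReal 0 1 x := by
    intro x; simp only [smul_eq_mul]; ring
  simp_rw [e1, e2, integral_neg, h, neg_neg]

theorem measurePreserving_gaussian_rotation {ρ : ℝ} (h0 : 0 ≤ ρ) (h1 : ρ ≤ 1) :
    MeasurePreserving (fun w : ℝ × ℝ => (ρ * w.1 + √(1 - ρ ^ 2) * w.2,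
      -√(1 - ρ ^ 2) * w.1 + ρ * w.2))
      ((gaussianReal 0 1).prod (gaussianReal 0 1)) ((gaussianReal 0 1).prod (gaussianReal 0 1)) := by
  refine ⟨by fun_prop, ?_⟩
  have := IsGaussian.map_rotation_eq_self (μ := gaussianReal 0 1) (by simp) (Real.arccos ρ)
  convert this using 2
  ext w <;> simp [ContinuousLinearMap.rotation_apply, Real.sin_arccos,
    Real.cos_arccos (by linarith : -1 ≤ ρ) h1]

theorem measurePreserving_gaussian_corr {ρ : ℝ} (h0 : 0 ≤ ρ) (h1 : ρ ≤ 1) :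
    MeasurePreserving (fun w : ℝ × ℝ => ρ * w.1 + √(1 - ρ ^ 2) * w.2)
      ((gaussianReal 0 1).prod (gaussianReal 0 1)) (gaussianReal 0 1) :=
  measurePreserving_fst.comp (measurePreserving_gaussian_rotation h0 h1)

theorem MeasurePreserving.integral_comp_of_integrable {X Y : Type*} [MeasurableSpace X]
    [MeasurableSpace Y] {μ : Measure X} {ν : Measure Y} {T : X → Y} (hT : MeasurePreserving T μ ν)
    {g : Y → ℝ} (hg : Integrable g ν) : ∫ x, g (T x) ∂μ = ∫ y, g y ∂ν := by
  have h := integral_map (μ := μ) hT.measurable.aemeasurable (f := g)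
    (by rw [hT.map_eq]; exact hg.aestronglyMeasurable)
  rw [hT.map_eq] at h
  exact h.symm

section Stein

variable {s s' : ℝ → ℝ}

theorem integrable_linear_mul_comp_fst (hs : MemLp s 2 (gaussianReal 0 1)) (α β : ℝ) :
    Integrable (fun w : ℝ × ℝ => (α * w.1 + β * w.2) * s w.1)
      ((gaussianReal 0 1).prod (gaussianReal 0 1)) := by
  have hid : MemLp (fun x : ℝ => x) 2 (gaussianReal 0 1) := memLp_id_gaussianReal 2
  refine MemLp.integrable_mul (p := 2) (q := 2) ?_ ?_
  · exact ((hid.comp_measurePreserving measurePreserving_fst).const_mul α).add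
      ((hid.comp_measurePreserving measurePreserving_snd).const_mul β)
  · exact hs.comp_measurePreserving measurePreserving_fst

theorem integral_linear_mul_comp_fst (hs : MemLp s 2 (gaussianReal 0 1))
    (hE : ∫ x, x * s x ∂gaussianReal 0 1 = ∫ x, s' x ∂gaussianReal 0 1) (α β : ℝ) :
    ∫ w : ℝ × ℝ, (α * w.1 + β * w.2) * s w.1 ∂(gaussianReal 0 1).prod (gaussianReal 0 1) =
      α * ∫ x, s' x ∂gaussianReal 0 1 := by
  have i1 := integrable_linear_mul_comp_fst hs α 0
  have i2 := integrable_linear_mul_comp_fst hs 0 β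
  have e : ∀ w : ℝ × ℝ, (α * w.1 + β * w.2) * s w.1 =
      (α * w.1 + 0 * w.2) * s w.1 + (0 * w.1 + β * w.2) * s w.1 := by
    intro w; ring
  simp_rw [e]
  rw [integral_add i1 i2]
  have e1 : ∀ w : ℝ × ℝ, (α * w.1 + 0 * w.2) * s w.1 = (α * (w.1 * s w.1)) * 1 := by
    intro w; ring
  have e2 : ∀ w : ℝ × ℝ, (0 * w.1 + β * w.2) * s w.1 = (β * s w.1) * w.2 := by
    intro w; ring
  simp_rw [e1, e2]
  rw [integral_prod_mul (fun x => α * (x * s x)) (fun _ => (1 : ℝ)),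
    integral_prod_mul (fun x => β * s x) (fun x : ℝ => x), integral_const_mul, hE]
  simp

end Stein

/-- Integration by parts gives `E[(X + Y) s(X)] = (1 + ρ) E s'`, and likewise for `t(Y)`. Since `ρ /
(1 - ρ^2) * (1 + ρ) = 1 / (1 - ρ) - 1`, the cross terms cancel the derivative terms and only the
square survives. -/
theorem integrable_integral_nonneg_of_stein {s s' t t' : ℝ → ℝ} {ρ : ℝ} (h0 : 0 ≤ ρ) (h1 : ρ < 1)
    (hs : MemLp s 2 (gaussianReal 0 1)) (hs' : Integrable s' (gaussianReal 0 1))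
    (hsE : ∫ x, x * s x ∂gaussianReal 0 1 = ∫ x, s' x ∂gaussianReal 0 1)
    (ht : MemLp t 2 (gaussianReal 0 1)) (ht' : Integrable t' (gaussianReal 0 1))
    (htE : ∫ x, x * t x ∂gaussianReal 0 1 = ∫ x, t' x ∂gaussianReal 0 1)
    {N : ℝ → ℝ → ℝ} (hN : ∀ x y, N x y = ρ / (1 - ρ ^ 2) * ((s x + t y) ^ 2 / 2) +
      ρ / (1 - ρ ^ 2) * ((x + y) * (s x + t y)) - (1 / (1 - ρ) - 1) * (s' x + t' y)) :
    Integrable (fun w : ℝ × ℝ => N w.1 (ρ * w.1 + √(1 - ρ ^ 2) * w.2))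
      ((gaussianReal 0 1).prod (gaussianReal 0 1)) ∧
    0 ≤ ∫ w : ℝ × ℝ, N w.1 (ρ * w.1 + √(1 - ρ ^ 2) * w.2)
      ∂(gaussianReal 0 1).prod (gaussianReal 0 1) := by
  set c := √(1 - ρ ^ 2) with hc
  have hq : 0 < 1 - ρ ^ 2 := by nlinarith
  have hcc : c * c = 1 - ρ ^ 2 := Real.mul_self_sqrt hq.le
  set ν := (gaussianReal 0 1).prod (gaussianReal 0 1) with hν
  have hY : MeasurePreserving (fun w : ℝ × ℝ => ρ * w.1 + c * w.2) ν (gaussianReal 0 1) :=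
    measurePreserving_gaussian_corr h0 h1.le
  have hX : MeasurePreserving (Prod.fst : ℝ × ℝ → ℝ) ν (gaussianReal 0 1) :=
    measurePreserving_fst
  have hrot : MeasurePreserving (fun w : ℝ × ℝ => (ρ * w.1 + c * w.2, -c * w.1 + ρ * w.2)) ν ν :=
    measurePreserving_gaussian_rotation h0 h1.le
  have hsq : Integrable (fun w : ℝ × ℝ => (s w.1 + t (ρ * w.1 + c * w.2)) ^ 2) ν :=
    MemLp.integrable_sq ((hs.comp_measurePreserving hX).add (ht.comp_measurePreserving hY))
  have iS := integrable_linear_mul_comp_fst hs (1 + ρ) c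
  have eS := integral_linear_mul_comp_fst hs hsE (1 + ρ) c
  -- The rotation turns `Y` into a first coordinate: with `W = -c w.1 + ρ w.2` one has `X + Y = (1 +
  -- ρ) Y - c W`, hence the coefficient `-c`.
  have iT0 := integrable_linear_mul_comp_fst ht (1 + ρ) (-c)
  have eT0 := integral_linear_mul_comp_fst ht htE (1 + ρ) (-c)
  have iT := hrot.integrable_comp_of_integrable iT0
  have eT : ∫ w, ((1 + ρ) * (ρ * w.1 + c * w.2) + -c * (-c * w.1 + ρ * w.2)) *
      t (ρ * w.1 + c * w.2) ∂ν = (1 + ρ) * ∫ x, t' x ∂gaussianReal 0 1 := by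
    rw [← eT0]
    exact MeasurePreserving.integral_comp_of_integrable hrot iT0
  have is' : Integrable (fun w : ℝ × ℝ => s' w.1) ν := hX.integrable_comp_of_integrable hs'
  have it' : Integrable (fun w : ℝ × ℝ => t' (ρ * w.1 + c * w.2)) ν :=
    hY.integrable_comp_of_integrable ht'
  have es' : ∫ w : ℝ × ℝ, s' w.1 ∂ν = ∫ x, s' x ∂gaussianReal 0 1 :=
    MeasurePreserving.integral_comp_of_integrable hX hs'
  have et' : ∫ w : ℝ × ℝ, t' (ρ * w.1 + c * w.2) ∂ν = ∫ x, t' x ∂gaussianReal 0 1 :=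
    MeasurePreserving.integral_comp_of_integrable hY ht'
  set κ := ρ / (1 - ρ ^ 2) with hκ
  have hk : κ * (1 + ρ) = 1 / (1 - ρ) - 1 := by
    have : 1 - ρ ≠ 0 := by linarith
    have h2 : 1 + ρ ≠ 0 := by linarith
    rw [hκ, show 1 - ρ ^ 2 = (1 - ρ) * (1 + ρ) by ring]
    field_simp
    ring
  have hκ0 : 0 ≤ κ := div_nonneg h0 hq.le
  have key : (fun w : ℝ × ℝ => N w.1 (ρ * w.1 + c * w.2)) = fun w =>
      κ / 2 * (s w.1 + t (ρ * w.1 + c * w.2)) ^ 2 +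
      (κ * (((1 + ρ) * w.1 + c * w.2) * s w.1) +
       κ * (((1 + ρ) * (ρ * w.1 + c * w.2) + -c * (-c * w.1 + ρ * w.2)) * t (ρ * w.1 + c * w.2)) -
       ((κ * (1 + ρ)) * s' w.1 + (κ * (1 + ρ)) * t' (ρ * w.1 + c * w.2))) := by
    funext w
    rw [hN, ← hk]
    linear_combination (- κ * w.1 * t (ρ * w.1 + c * w.2)) * hcc
  have i1 := hsq.const_mul (κ / 2)
  have i2 := iS.const_mul κ
  have i3 : Integrable (fun w : ℝ × ℝ => κ * (((1 + ρ) * (ρ * w.1 + c * w.2) +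
    -c * (-c * w.1 + ρ * w.2)) * t (ρ * w.1 + c * w.2))) ν := iT.const_mul κ
  have i4 := is'.const_mul (κ * (1 + ρ))
  have i5 := it'.const_mul (κ * (1 + ρ))
  have i23 : Integrable (fun w : ℝ × ℝ => κ * (((1 + ρ) * w.1 + c * w.2) * s w.1) +
    κ * (((1 + ρ) * (ρ * w.1 + c * w.2) + -c * (-c * w.1 + ρ * w.2)) *
      t (ρ * w.1 + c * w.2))) ν := i2.add i3
  have i45 : Integrable (fun w : ℝ × ℝ => (κ * (1 + ρ)) * s' w.1 +
    (κ * (1 + ρ)) * t' (ρ * w.1 + c * w.2)) ν := i4.add i5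
  have i25 : Integrable (fun w : ℝ × ℝ => κ * (((1 + ρ) * w.1 + c * w.2) * s w.1) +
    κ * (((1 + ρ) * (ρ * w.1 + c * w.2) + -c * (-c * w.1 + ρ * w.2)) *
      t (ρ * w.1 + c * w.2)) - ((κ * (1 + ρ)) * s' w.1 +
    (κ * (1 + ρ)) * t' (ρ * w.1 + c * w.2))) ν := i23.sub i45
  rw [key]
  refine ⟨i1.add i25, ?_⟩
  rw [integral_add i1 i25, integral_sub i23 i45, integral_add i2 i3, integral_add i4 i5, integral_const_mul, integral_const_mul,
    integral_const_mul, integral_const_mul, integral_const_mul, eS, eT, es', et']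
  have : 0 ≤ ∫ w : ℝ × ℝ, (s w.1 + t (ρ * w.1 + c * w.2)) ^ 2 ∂ν :=
    integral_nonneg fun w => sq_nonneg _
  have := mul_nonneg (by linarith : 0 ≤ κ / 2) this
  linarith

/-! ### The one-dimensional inequality for continuous positive functions. -/

theorem lintegral_gaussian_corr {ρ c : ℝ} {q : NNReal} (hq : q ≠ 0) (hqc : (q : ℝ) = c ^ 2) {Ψ : ℝ → ℝ → ENNReal}
    (hΨ : Measurable (Function.uncurry Ψ)) :
    ∫⁻ w : ℝ × ℝ, Ψ w.1 (ρ * w.1 + c * w.2) ∂(gaussianReal 0 1).prod (gaussianReal 0 1) =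
      ∫⁻ x, ∫⁻ y, ENNReal.ofReal (gaussianPDFReal 0 1 x *
        gaussianPDFReal (ρ * x) q y) * Ψ x y := by
  have hqm : q = NNReal.mk (c ^ 2) (sq_nonneg c) * 1 := NNReal.eq (by simp [hqc])
  have hm : Measurable fun w : ℝ × ℝ => Ψ w.1 (ρ * w.1 + c * w.2) :=
    hΨ.comp (f := fun w : ℝ × ℝ => (w.1, ρ * w.1 + c * w.2)) (by fun_prop)
  have hΨx : ∀ x, Measurable (Ψ x) := fun x => hΨ.comp measurable_prodMk_left
  rw [lintegral_prod _ hm.aemeasurable]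
  have hin : ∀ x, ∫⁻ z, Ψ x (ρ * x + c * z) ∂gaussianReal 0 1 =
      ∫⁻ y, ENNReal.ofReal (gaussianPDFReal (ρ * x) q y) * Ψ x y := by
    intro x
    have hmap : (gaussianReal 0 1).map (fun z => ρ * x + c * z) =
        gaussianReal (ρ * x) q := by
      have h1 := gaussianReal_map_const_mul (μ := 0) (v := 1) c
      have h2 := gaussianReal_map_const_add (μ := c * 0) (v := q) (ρ * x)
      rw [← hqm] at h1
      rw [← h1, Measure.map_map (by fun_prop) (by fun_prop)] at h2
      simpa [Function.comp_def, h1] using h2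
    rw [← lintegral_map (hΨx x) (by fun_prop), hmap, gaussianReal_of_var_ne_zero _ hq,
      lintegral_withDensity_eq_lintegral_mul _ (measurable_gaussianPDF _ _) (hΨx x)]
    rfl
  simp_rw [hin]
  have hpdf : Measurable fun w : ℝ × ℝ =>
      gaussianPDFReal (ρ * w.1) q w.2 := by
    unfold gaussianPDFReal; fun_prop
  have hm2 : Measurable fun x => ∫⁻ y,
      ENNReal.ofReal (gaussianPDFReal (ρ * x) q y) * Ψ x y :=
    Measurable.lintegral_prod_right' (f := fun w : ℝ × ℝ =>
      ENNReal.ofReal (gaussianPDFReal (ρ * w.1) q w.2) * Ψ w.1 w.2)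
      (hpdf.ennreal_ofReal.mul hΨ)
  rw [gaussianReal_of_var_ne_zero _ one_ne_zero,
    lintegral_withDensity_eq_lintegral_mul _ (measurable_gaussianPDF _ _) hm2]
  refine lintegral_congr fun x => ?_
  have hpx : Measurable fun y => gaussianPDFReal (ρ * x) q y :=
    measurable_gaussianPDFReal _ _
  have hmx : Measurable fun y => ENNReal.ofReal (gaussianPDFReal (ρ * x) q y) * Ψ x y :=
    hpx.ennreal_ofReal.mul (hΨx x)
  rw [Pi.mul_apply, ← lintegral_const_mul _ hmx]
  refine lintegral_congr fun y => ?_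
  rw [ENNReal.ofReal_mul (gaussianPDFReal_nonneg _ _ _), mul_assoc]
  rfl

theorem lintegral_deriv_mul_comp_le {S S' : ℝ → ℝ} (hS : ∀ w, HasDerivAt S (S' w) w)
    (hinj : Function.Injective S) (hpos : ∀ w, 0 < S' w) (H : ℝ → ENNReal) :
    ∫⁻ x, ENNReal.ofReal (S' x) * H (S x) ≤ ∫⁻ x, H x := by
  have h := lintegral_image_eq_lintegral_abs_deriv_mul MeasurableSet.univ
    (fun x _ => (hS x).hasDerivWithinAt) hinj.injOn H
  simp_rw [abs_of_pos (hpos _), Measure.restrict_univ] at h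
  rw [← h]
  exact setLIntegral_le_lintegral _ _

theorem ofReal_integral_le_lintegral_ofReal {X : Type*} [MeasurableSpace X] {μ : Measure X}
    {f : X → ℝ} (hf : Integrable f μ) :
    ENNReal.ofReal (∫ x, f x ∂μ) ≤ ∫⁻ x, ENNReal.ofReal (f x) ∂μ := by
  rw [integral_eq_lintegral_pos_part_sub_lintegral_neg_part hf]
  exact (ENNReal.ofReal_le_ofReal (sub_le_self _ ENNReal.toReal_nonneg)).trans
    ENNReal.ofReal_toReal_le

/-- The transport argument proper. Truncation affects only the norms on the left, so `R` can later
tend to infinity with the right side fixed. -/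
theorem le_lintegral_gaussian_corr_of_continuous_truncated {ρ : ℝ} (h0 : 0 ≤ ρ) (h1 : ρ < 1)
    {f g : ℝ → ℝ} (hf : Continuous f) (hf0 : ∀ x, 0 < f x) (hg : Continuous g)
    (hg0 : ∀ x, 0 < g x) {R : ℝ} (hR : 0 < R) :
    ENNReal.ofReal ((∫ x in -R..R, f x ^ (1 - ρ) * gaussianPDFReal 0 1 x) ^ (1 / (1 - ρ)) *
      (∫ x in -R..R, g x ^ (1 - ρ) * gaussianPDFReal 0 1 x) ^ (1 / (1 - ρ))) ≤
    ∫⁻ w : ℝ × ℝ, ENNReal.ofReal (f w.1) * ENNReal.ofReal (g (ρ * w.1 + √(1 - ρ ^ 2) * w.2))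
      ∂(gaussianReal 0 1).prod (gaussianReal 0 1) := by
  have hp : 0 < 1 - ρ := by linarith
  have hp' : 0 < 1 + ρ := by linarith
  have hq : 0 < 1 - ρ ^ 2 := by nlinarith
  obtain ⟨S, S', B, hS, hSi, hS'c, hSR, hS'0, hS'B, hSf⟩ :=
    exists_gaussian_transport hf hf0 hp (by linarith) hR
  obtain ⟨T, T', D, hT, hTi, hT'c, hTR, hT'0, hT'B, hTg⟩ :=
    exists_gaussian_transport hg hg0 hp (by linarith) hR
  set Cf := (∫ x in -R..R, f x ^ (1 - ρ) * gaussianPDFReal 0 1 x) ^ (1 / (1 - ρ)) with hCf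
  set Cg := (∫ x in -R..R, g x ^ (1 - ρ) * gaussianPDFReal 0 1 x) ^ (1 / (1 - ρ)) with hCg
  have hCnn : ∀ h : ℝ → ℝ, (∀ x, 0 < h x) →
      0 ≤ (∫ x in -R..R, h x ^ (1 - ρ) * gaussianPDFReal 0 1 x) ^ (1 / (1 - ρ)) := fun h hh =>
    Real.rpow_nonneg (intervalIntegral.integral_nonneg (by linarith) fun x _ =>
      mul_nonneg (Real.rpow_nonneg (hh x).le _) (gaussianPDFReal_nonneg 0 1 x)) _
  have hCf0 : 0 ≤ Cf := hCnn f hf0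
  have hCg0 : 0 ≤ Cg := hCnn g hg0
  have stein : ∀ {S S' : ℝ → ℝ} {B : ℝ}, (∀ w, HasDerivAt S (S' w) w) → Continuous S' →
      (∀ w, |S w| ≤ R) → (∀ w, 0 < S' w) → (∀ w, S' w ≤ B) →
      MemLp (fun x => S x - x) 2 (gaussianReal 0 1) ∧
      Integrable (fun x => S' x - 1) (gaussianReal 0 1) ∧
      ∫ x, x * (S x - x) ∂gaussianReal 0 1 = ∫ x, (S' x - 1) ∂gaussianReal 0 1 := by
    intro S S' B hS hS'c hSR hS'0 hS'B
    have hid : MemLp (fun x : ℝ => x) 2 (gaussianReal 0 1) := memLp_id_gaussianReal 2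
    have hSm : MemLp S 2 (gaussianReal 0 1) := MemLp.of_bound
      (continuous_iff_continuousAt.2 fun x => (hS x).continuousAt).aestronglyMeasurable R
      (Filter.Eventually.of_forall hSR)
    have hb : ∀ w, |S' w| ≤ B := fun w => by rw [abs_of_pos (hS'0 w)]; exact hS'B w
    have hS'i : Integrable S' (gaussianReal 0 1) :=
      Integrable.of_bound hS'c.aestronglyMeasurable B (Filter.Eventually.of_forall hb)
    refine ⟨hSm.sub hid, hS'i.sub (integrable_const 1), ?_⟩
    have hsq : ∫ x : ℝ, x * x ∂gaussianReal 0 1 = 1 := by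
      have h := variance_id_gaussianReal (μ := 0) (v := 1)
      rw [variance_eq_integral aemeasurable_id] at h
      simpa [pow_two] using h
    simp_rw [mul_sub]
    have i1 : Integrable (fun x => x * S x) (gaussianReal 0 1) := hid.integrable_mul hSm
    have i2 : Integrable (fun x : ℝ => x * x) (gaussianReal 0 1) := hid.integrable_mul hid
    rw [integral_sub i1 i2, integral_sub hS'i (integrable_const 1),
      integral_mul_gaussianReal_of_bounded hS hS'c hSR hb, hsq]
    simp
  obtain ⟨hs2, hs'i, hsE⟩ := stein hS hS'c hSR hS'0 hS'B
  obtain ⟨ht2, ht'i, htE⟩ := stein hT hT'c hTR hT'0 hT'B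
  obtain ⟨hNi, hN0⟩ := integrable_integral_nonneg_of_stein h0 h1 hs2 hs'i hsE ht2 ht'i htE
    (N := fun x y => ρ / (1 - ρ ^ 2) * (((S x - x) + (T y - y)) ^ 2 / 2) +
      ρ / (1 - ρ ^ 2) * ((x + y) * ((S x - x) + (T y - y))) -
      (1 / (1 - ρ) - 1) * ((S' x - 1) + (T' y - 1))) (fun x y => rfl)
  set N : ℝ → ℝ → ℝ := fun x y => ρ / (1 - ρ ^ 2) * (((S x - x) + (T y - y)) ^ 2 / 2) +
      ρ / (1 - ρ ^ 2) * ((x + y) * ((S x - x) + (T y - y))) -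
      (1 / (1 - ρ) - 1) * ((S' x - 1) + (T' y - 1)) with hN
  have hSc : Continuous S := continuous_iff_continuousAt.2 fun x => (hS x).continuousAt
  have hTc : Continuous T := continuous_iff_continuousAt.2 fun x => (hT x).continuousAt
  have hNm : Measurable fun w : ℝ × ℝ => N w.1 w.2 := by
    simp only [hN]; fun_prop
  set c := √(1 - ρ ^ 2) with hc
  set q : NNReal := ⟨1 - ρ ^ 2, hq.le⟩ with hqd
  have hqv : (q : ℝ) = 1 - ρ ^ 2 := rfl
  have hqc : (q : ℝ) = c ^ 2 := by rw [hqv, hc, Real.sq_sqrt hq.le]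
  have hq0 : q ≠ 0 := fun h => hq.ne' (by rw [← hqv, h]; rfl)
  set K : ℝ → ℝ → ℝ := fun x y => gaussianPDFReal 0 1 x * gaussianPDFReal (ρ * x) q y with hK
  have hK0 : ∀ x y, 0 ≤ K x y := fun x y =>
    mul_nonneg (gaussianPDFReal_nonneg _ _ _) (gaussianPDFReal_nonneg _ _ _)
  set A := (√(2 * Real.pi))⁻¹ * (√(2 * Real.pi * q))⁻¹ with hA
  have hKexp : ∀ x y, K x y = A *
      Real.exp (-(x ^ 2 - 2 * ρ * x * y + y ^ 2) / (2 * (1 - ρ ^ 2))) := by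
    intro x y
    simp only [hK]
    rw [gaussianPDFReal_std, gaussianPDFReal, hA, hqv]
    rw [show ∀ a b c d : ℝ, a * b * (c * d) = a * c * (b * d) from fun a b c d => by ring,
      ← Real.exp_add]
    congr 2
    field_simp
    ring
  -- The quadratic terms combine to `ρ / (2 (1 - ρ^2)) * ((S x + T y)^2 - (x + y)^2)`. Expanding in
  -- the displacements `S x - x` and `T y - y` gives the quadratic part of `N`; `exp N ≥ 1 + N`
  -- finishes.
  have hpt : ∀ x y, (Cf * Cg) * ((1 + N x y) * K x y) ≤
      S' x * (T' y * (K (S x) (T y) * (f (S x) * g (T y)))) := by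
    intro x y
    have h2 := mul_le_mul (hSf x) (hTg y) (mul_nonneg hCg0 (Real.exp_pos _).le)
      (mul_pos (hf0 _) (hS'0 _)).le
    have h3 := mul_le_mul_of_nonneg_right h2 (hK0 (S x) (T y))
    have h4 : Cf * Real.exp (-(1 / (1 - ρ) - 1) * (S' x - 1) + (S x ^ 2 - x ^ 2) / (2 * (1 - ρ))) *
        (Cg * Real.exp (-(1 / (1 - ρ) - 1) * (T' y - 1) + (T y ^ 2 - y ^ 2) / (2 * (1 - ρ)))) *
        K (S x) (T y) = Cf * Cg * (Real.exp (N x y) * K x y) := by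
      rw [hKexp, hKexp]
      have e1 : ∀ a b c d e f : ℝ, a * b * (c * d) * (e * f) = a * c * (e * (b * d * f)) :=
        fun a b c d e f => by ring
      have e2 : ∀ b e f : ℝ, b * (e * f) = e * (b * f) := fun b e f => by ring
      rw [e1, e2 (Real.exp (N x y)), ← Real.exp_add, ← Real.exp_add, ← Real.exp_add]
      congr 3
      simp only [hN]
      rw [show 1 - ρ ^ 2 = (1 - ρ) * (1 + ρ) by ring]
      field_simp
      ring
    calc (Cf * Cg) * ((1 + N x y) * K x y)
        ≤ Cf * Cg * (Real.exp (N x y) * K x y) := by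
          refine mul_le_mul_of_nonneg_left (mul_le_mul_of_nonneg_right ?_ (hK0 x y))
            (mul_nonneg hCf0 hCg0)
          linarith [Real.add_one_le_exp (N x y)]
      _ ≤ _ := h4 ▸ h3
      _ = _ := by ring
  have hfm : Measurable f := hf.measurable
  have hgm : Measurable g := hg.measurable
  calc ENNReal.ofReal (Cf * Cg)
      ≤ ENNReal.ofReal (Cf * Cg) * ENNReal.ofReal (∫ w : ℝ × ℝ, (1 + N w.1 (ρ * w.1 + c * w.2))
          ∂(gaussianReal 0 1).prod (gaussianReal 0 1)) := by
        refine le_mul_of_one_le_right' ?_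
        rw [integral_add (integrable_const 1) hNi]
        rw [ENNReal.one_le_ofReal]
        simpa using hN0
    _ ≤ ENNReal.ofReal (Cf * Cg) * ∫⁻ w : ℝ × ℝ, ENNReal.ofReal (1 + N w.1 (ρ * w.1 + c * w.2))
          ∂(gaussianReal 0 1).prod (gaussianReal 0 1) := by
        gcongr
        exact ofReal_integral_le_lintegral_ofReal ((integrable_const 1).add hNi)
    _ = ∫⁻ x, ∫⁻ y, ENNReal.ofReal (K x y) *
          (ENNReal.ofReal (Cf * Cg) * ENNReal.ofReal (1 + N x y)) := by
        rw [← lintegral_const_mul']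
        · exact lintegral_gaussian_corr hq0 hqc (Ψ := fun x y =>
            ENNReal.ofReal (Cf * Cg) * ENNReal.ofReal (1 + N x y))
            (((hNm.const_add 1).ennreal_ofReal).const_mul _)
        · exact ENNReal.ofReal_ne_top
    _ ≤ ∫⁻ x, ENNReal.ofReal (S' x) * ∫⁻ y, ENNReal.ofReal (T' y) *
          (ENNReal.ofReal (K (S x) (T y)) *
            (ENNReal.ofReal (f (S x)) * ENNReal.ofReal (g (T y)))) := by
        refine lintegral_mono fun x => ?_
        rw [← lintegral_const_mul' _ _ ENNReal.ofReal_ne_top]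
        refine lintegral_mono fun y => ?_
        rw [← ENNReal.ofReal_mul (mul_nonneg hCf0 hCg0), ← ENNReal.ofReal_mul (hK0 x y),
          ← ENNReal.ofReal_mul (hf0 _).le, ← ENNReal.ofReal_mul (hK0 _ _),
          ← ENNReal.ofReal_mul (hT'0 y).le, ← ENNReal.ofReal_mul (hS'0 x).le]
        refine ENNReal.ofReal_le_ofReal (le_trans (le_of_eq ?_) (hpt x y))
        ring
    -- Undo the substitutions, `T` and then `S`; the images need not cover the line, so only
    -- inequalities hold.
    _ ≤ ∫⁻ x, ENNReal.ofReal (S' x) * ∫⁻ y, ENNReal.ofReal (K (S x) y) *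
            (ENNReal.ofReal (f (S x)) * ENNReal.ofReal (g y)) := by
        refine lintegral_mono fun x => ?_
        refine mul_le_mul_right ?_ _
        exact lintegral_deriv_mul_comp_le hT hTi hT'0 fun y => ENNReal.ofReal (K (S x) y) *
            (ENNReal.ofReal (f (S x)) * ENNReal.ofReal (g y))
    _ ≤ ∫⁻ x, ∫⁻ y, ENNReal.ofReal (K x y) * (ENNReal.ofReal (f x) * ENNReal.ofReal (g y)) :=
        lintegral_deriv_mul_comp_le hS hSi hS'0 fun x => ∫⁻ y, ENNReal.ofReal (K x y) *
            (ENNReal.ofReal (f x) * ENNReal.ofReal (g y))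
    _ = _ := by
        symm
        exact lintegral_gaussian_corr hq0 hqc (Ψ := fun x y =>
          ENNReal.ofReal (f x) * ENNReal.ofReal (g y))
          ((hfm.comp measurable_fst).ennreal_ofReal.mul (hgm.comp measurable_snd).ennreal_ofReal)

theorem le_lintegral_gaussian_corr_of_continuous {ρ : ℝ} (h0 : 0 ≤ ρ) (h1 : ρ < 1)
    {f g : ℝ → ℝ} {M : ℝ} (hf : Continuous f) (hf0 : ∀ x, 0 < f x) (hfM : ∀ x, f x ≤ M)
    (hg : Continuous g) (hg0 : ∀ x, 0 < g x) (hgM : ∀ x, g x ≤ M) :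
    (∫⁻ x, ENNReal.ofReal (f x) ^ (1 - ρ) ∂gaussianReal 0 1) ^ (1 / (1 - ρ)) *
      (∫⁻ x, ENNReal.ofReal (g x) ^ (1 - ρ) ∂gaussianReal 0 1) ^ (1 / (1 - ρ)) ≤
    ∫⁻ w : ℝ × ℝ, ENNReal.ofReal (f w.1) * ENNReal.ofReal (g (ρ * w.1 + √(1 - ρ ^ 2) * w.2))
      ∂(gaussianReal 0 1).prod (gaussianReal 0 1) := by
  have hp : 0 < 1 - ρ := by linarith
  have hlim : ∀ f : ℝ → ℝ, Continuous f → (∀ x, 0 < f x) → (∀ x, f x ≤ M) →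
      (∫⁻ x, ENNReal.ofReal (f x) ^ (1 - ρ) ∂gaussianReal 0 1) ^ (1 / (1 - ρ)) =
        ENNReal.ofReal ((∫ x, f x ^ (1 - ρ) * gaussianPDFReal 0 1 x) ^ (1 / (1 - ρ))) ∧
      Filter.Tendsto (fun R : ℝ => (∫ x in -R..R, f x ^ (1 - ρ) * gaussianPDFReal 0 1 x) ^
        (1 / (1 - ρ))) Filter.atTop
        (nhds ((∫ x, f x ^ (1 - ρ) * gaussianPDFReal 0 1 x) ^ (1 / (1 - ρ)))) := by
    intro f hf hf0 hfM
    have hfp : Continuous fun x => f x ^ (1 - ρ) := hf.rpow_const fun x => Or.inl (hf0 x).ne'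
    have hbd : ∀ x, ‖f x ^ (1 - ρ)‖ ≤ M ^ (1 - ρ) := fun x => by
      rw [Real.norm_of_nonneg (Real.rpow_nonneg (hf0 x).le _)]
      exact Real.rpow_le_rpow (hf0 x).le (hfM x) hp.le
    have hint : Integrable fun x => f x ^ (1 - ρ) * gaussianPDFReal 0 1 x :=
      (integrable_gaussianPDFReal 0 1).bdd_mul hfp.aestronglyMeasurable
        (Filter.Eventually.of_forall hbd)
    have hintγ : Integrable (fun x => f x ^ (1 - ρ)) (gaussianReal 0 1) :=
      Integrable.of_bound hfp.aestronglyMeasurable _ (Filter.Eventually.of_forall hbd)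
    constructor
    · have h1 : ∫⁻ x, ENNReal.ofReal (f x) ^ (1 - ρ) ∂gaussianReal 0 1 =
          ENNReal.ofReal (∫ x, f x ^ (1 - ρ) * gaussianPDFReal 0 1 x) := by
        have h2 := integral_gaussianReal_eq_integral_smul (μ := 0) (v := 1) one_ne_zero
          (f := fun x => f x ^ (1 - ρ))
        simp only [smul_eq_mul, mul_comm (gaussianPDFReal 0 1 _)] at h2
        rw [← h2, ofReal_integral_eq_lintegral_ofReal hintγ
          (Filter.Eventually.of_forall fun x => Real.rpow_nonneg (hf0 x).le _)]
        exact lintegral_congr fun x => ENNReal.ofReal_rpow_of_pos (hf0 x)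
      rw [h1, ENNReal.ofReal_rpow_of_nonneg _ (by positivity)]
      exact integral_nonneg fun x => mul_nonneg (Real.rpow_nonneg (hf0 x).le _)
        (gaussianPDFReal_nonneg _ _ _)
    · exact (intervalIntegral_tendsto_integral hint Filter.tendsto_neg_atTop_atBot
        Filter.tendsto_id).rpow_const (Or.inr (by positivity))
  obtain ⟨ef, lf⟩ := hlim f hf hf0 hfM
  obtain ⟨eg, lg⟩ := hlim g hg hg0 hgM
  rw [ef, eg, ← ENNReal.ofReal_mul]
  · refine le_of_tendsto (ENNReal.tendsto_ofReal (lf.mul lg)) ?_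
    filter_upwards [Filter.eventually_gt_atTop 0] with R hR
    exact le_lintegral_gaussian_corr_of_continuous_truncated h0 h1 hf hf0 hg hg0 hR
  · exact Real.rpow_nonneg (integral_nonneg fun x => mul_nonneg (Real.rpow_nonneg (hf0 x).le _)
        (gaussianPDFReal_nonneg _ _ _)) _

/-! ### Passage to bounded measurable functions. -/

/-- Approximate in `L¹` by bounded continuous functions, extract an a.e. convergent subsequence,
clamp to `[0, M]`, and add `1 / (n + 1)` for strict positivity; hence the bound `M + 1`. -/
theorem exists_continuous_pos_tendsto_ae {μ : Measure ℝ} [IsFiniteMeasure μ] {f : ℝ → ℝ} {M : ℝ}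
    (hf : Measurable f) (hf0 : ∀ x, 0 ≤ f x) (hfM : ∀ x, f x ≤ M) :
    ∃ F : ℕ → ℝ → ℝ, (∀ n, Continuous (F n)) ∧ (∀ n x, 0 < F n x) ∧ (∀ n x, F n x ≤ M + 1) ∧
      ∀ᵐ x ∂μ, Filter.Tendsto (fun n => F n x) Filter.atTop (nhds (f x)) := by
  have hM : 0 ≤ M := (hf0 0).trans (hfM 0)
  have hfm : MemLp f 1 μ := MemLp.of_bound hf.aestronglyMeasurable M
    (Filter.Eventually.of_forall fun x => by rw [Real.norm_of_nonneg (hf0 x)]; exact hfM x)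
  have hex : ∀ n : ℕ, ∃ g : BoundedContinuousFunction ℝ ℝ,
      eLpNorm (f - (g : ℝ → ℝ)) 1 μ ≤ ((n : ENNReal) + 1)⁻¹ ∧ MemLp (g : ℝ → ℝ) 1 μ := fun n =>
    hfm.exists_boundedContinuous_eLpNorm_sub_le ENNReal.one_ne_top (by simp)
  choose G hG hGm using hex
  have ht : Filter.Tendsto (fun n => eLpNorm ((G n : ℝ → ℝ) - f) 1 μ) Filter.atTop (nhds 0) := by
    have h2 : Filter.Tendsto (fun n : ℕ => ((n : ENNReal) + 1)⁻¹) Filter.atTop (nhds 0) := by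
      have := (Filter.tendsto_add_atTop_iff_nat 1).2 ENNReal.tendsto_inv_nat_nhds_zero
      simpa using this
    refine tendsto_of_tendsto_of_tendsto_of_le_of_le tendsto_const_nhds h2 (fun n => zero_le)
      fun n => ?_
    rw [eLpNorm_sub_comm]
    exact hG n
  obtain ⟨ns, -, hns⟩ := (tendstoInMeasure_of_tendsto_eLpNorm one_ne_zero
    (fun n => (hGm n).aestronglyMeasurable) hfm.aestronglyMeasurable ht).exists_seq_tendsto_ae
  have hpos : ∀ n : ℕ, (0 : ℝ) < 1 / ((n : ℝ) + 1) := fun n => by positivity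
  refine ⟨fun n x => max 0 (min (G (ns n) x) M) + 1 / ((n : ℝ) + 1), fun n => ?_, fun n x => ?_,
    fun n x => ?_, ?_⟩
  · have := (G (ns n)).continuous
    fun_prop
  · exact add_pos_of_nonneg_of_pos (le_max_left _ _) (hpos n)
  · refine add_le_add (max_le hM (min_le_right _ _)) ?_
    rw [div_le_one (by positivity)]
    linarith [(Nat.cast_nonneg n : (0 : ℝ) ≤ n)]
  · filter_upwards [hns] with x hx
    have h1 : max 0 (min (f x) M) = f x := by rw [min_eq_left (hfM x), max_eq_right (hf0 x)]
    have h2 := ((tendsto_const_nhds (x := (0 : ℝ))).max (hx.min (tendsto_const_nhds (x := M)))).add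
      tendsto_one_div_add_atTop_nhds_zero_nat
    rwa [h1, add_zero] at h2

theorem le_lintegral_gaussian_corr_of_bounded {ρ : ℝ} (h0 : 0 ≤ ρ) (h1 : ρ < 1)
    {f g : ℝ → ℝ} {M : ℝ} (hf : Measurable f) (hf0 : ∀ x, 0 ≤ f x) (hfM : ∀ x, f x ≤ M)
    (hg : Measurable g) (hg0 : ∀ x, 0 ≤ g x) (hgM : ∀ x, g x ≤ M) :
    (∫⁻ x, ENNReal.ofReal (f x) ^ (1 - ρ) ∂gaussianReal 0 1) ^ (1 / (1 - ρ)) *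
      (∫⁻ x, ENNReal.ofReal (g x) ^ (1 - ρ) ∂gaussianReal 0 1) ^ (1 / (1 - ρ)) ≤
    ∫⁻ w : ℝ × ℝ, ENNReal.ofReal (f w.1) * ENNReal.ofReal (g (ρ * w.1 + √(1 - ρ ^ 2) * w.2))
      ∂(gaussianReal 0 1).prod (gaussianReal 0 1) := by
  have hp : 0 < 1 - ρ := by linarith
  obtain ⟨F, hFc, hFp, hFM, hFt⟩ :=
    exists_continuous_pos_tendsto_ae (μ := gaussianReal 0 1) hf hf0 hfM
  obtain ⟨G, hGc, hGp, hGM, hGt⟩ :=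
    exists_continuous_pos_tendsto_ae (μ := gaussianReal 0 1) hg hg0 hgM
  have hL : ∀ {f : ℝ → ℝ} {F : ℕ → ℝ → ℝ}, (∀ n, Continuous (F n)) → (∀ n x, F n x ≤ M + 1) →
      (∀ x, f x ≤ M) →
      (∀ᵐ x ∂gaussianReal 0 1, Filter.Tendsto (fun n => F n x) Filter.atTop (nhds (f x))) →
      Filter.Tendsto (fun n => (∫⁻ x, ENNReal.ofReal (F n x) ^ (1 - ρ) ∂gaussianReal 0 1) ^
        (1 / (1 - ρ))) Filter.atTop
        (nhds ((∫⁻ x, ENNReal.ofReal (f x) ^ (1 - ρ) ∂gaussianReal 0 1) ^ (1 / (1 - ρ)))) ∧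
      (∫⁻ x, ENNReal.ofReal (f x) ^ (1 - ρ) ∂gaussianReal 0 1) ^ (1 / (1 - ρ)) ≠ ⊤ := by
    intro f F hFc hFM hfM hFt
    have htop : ∀ K : ℝ, ENNReal.ofReal K ^ (1 - ρ) ≠ ⊤ := fun K =>
      ENNReal.rpow_ne_top_of_nonneg hp.le ENNReal.ofReal_ne_top
    constructor
    · refine (ENNReal.continuous_rpow_const.tendsto _).comp ?_
      refine tendsto_lintegral_of_dominated_convergence
        (fun _ => ENNReal.ofReal (M + 1) ^ (1 - ρ)) (fun n => ?_) (fun n => ?_) ?_ ?_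
      · exact (hFc n).measurable.ennreal_ofReal.pow_const _
      · exact Filter.Eventually.of_forall fun x =>
          ENNReal.rpow_le_rpow (ENNReal.ofReal_le_ofReal (hFM n x)) hp.le
      · simpa using htop (M + 1)
      · filter_upwards [hFt] with x hx
        exact (ENNReal.continuous_rpow_const.tendsto _).comp (ENNReal.tendsto_ofReal hx)
    · refine ENNReal.rpow_ne_top_of_nonneg (by positivity) ?_
      refine ((lintegral_mono fun x => ENNReal.rpow_le_rpow
        (ENNReal.ofReal_le_ofReal (hfM x)) hp.le).trans_lt ?_).ne
      simpa using (htop M).lt_top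
  obtain ⟨lf, tf⟩ := hL hFc hFM hfM hFt
  obtain ⟨lg, tg⟩ := hL hGc hGM hgM hGt
  refine le_of_tendsto_of_tendsto' (ENNReal.Tendsto.mul lf (Or.inr tg) lg (Or.inr tf)) ?_
    fun n => le_lintegral_gaussian_corr_of_continuous h0 h1 (hFc n) (hFp n) (hFM n) (hGc n) (hGp n)
      (hGM n)
  refine tendsto_lintegral_of_dominated_convergence
    (fun _ => ENNReal.ofReal (M + 1) * ENNReal.ofReal (M + 1)) (fun n => ?_) (fun n => ?_) ?_ ?_
  · have h1 := (hFc n).measurable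
    have h2 := (hGc n).measurable
    fun_prop
  · exact Filter.Eventually.of_forall fun w =>
      mul_le_mul' (ENNReal.ofReal_le_ofReal (hFM n _)) (ENNReal.ofReal_le_ofReal (hGM n _))
  · simp [ENNReal.mul_ne_top]
  · have a1 := (measurePreserving_fst (μ := gaussianReal 0 1)
      (ν := gaussianReal 0 1)).quasiMeasurePreserving.ae hFt
    have a2 := (measurePreserving_gaussian_corr h0 h1.le).quasiMeasurePreserving.ae hGt
    filter_upwards [a1, a2] with w hw1 hw2
    exact ENNReal.Tendsto.mul (ENNReal.tendsto_ofReal hw1) (Or.inr ENNReal.ofReal_ne_top)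
      (ENNReal.tendsto_ofReal hw2) (Or.inr ENNReal.ofReal_ne_top)

/-! ### Extended-valued functions and tensorization. -/

/-- Two-function reverse hypercontractivity with parameters `ρ, c` and exponent `1 - ρ`. -/
def ReverseHypercontractive {E : Type*} [AddCommGroup E] [Module ℝ E] [MeasurableSpace E]
    (ρ c : ℝ) (μ : Measure E) : Prop :=
  ∀ f g : E → ENNReal, Measurable f → Measurable g →
    (∫⁻ x, f x ^ (1 - ρ) ∂μ) ^ (1 / (1 - ρ)) * (∫⁻ x, g x ^ (1 - ρ) ∂μ) ^ (1 / (1 - ρ)) ≤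
      ∫⁻ x, ∫⁻ z, f x * g (ρ • x + c • z) ∂μ ∂μ

theorem reverseHypercontractive_gaussianReal {ρ : ℝ} (h0 : 0 ≤ ρ) (h1 : ρ < 1) :
    ReverseHypercontractive ρ √(1 - ρ ^ 2) (gaussianReal 0 1) := by
  intro f g hf hg
  have hp : 0 < 1 - ρ := by linarith
  have hp' : 0 < 1 / (1 - ρ) := by positivity
  simp only [smul_eq_mul]
  rw [lintegral_lintegral (f := fun x z => f x * g (ρ * x + √(1 - ρ ^ 2) * z))
    (by fun_prop)]
  have hL : ∀ f : ℝ → ENNReal, Measurable f →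
      Filter.Tendsto (fun n : ℕ => (∫⁻ x, min (f x) n ^ (1 - ρ) ∂gaussianReal 0 1) ^
        (1 / (1 - ρ))) Filter.atTop
        (nhds ((∫⁻ x, f x ^ (1 - ρ) ∂gaussianReal 0 1) ^ (1 / (1 - ρ)))) := by
    intro f hf
    refine (ENNReal.continuous_rpow_const.tendsto _).comp ?_
    refine lintegral_tendsto_of_tendsto_of_monotone (fun n => by fun_prop) ?_ ?_
    · refine Filter.Eventually.of_forall fun x m n hmn => ?_
      exact ENNReal.rpow_le_rpow (min_le_min le_rfl (by exact_mod_cast hmn)) hp.le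
    · refine Filter.Eventually.of_forall fun x => ?_
      refine (ENNReal.continuous_rpow_const.tendsto _).comp ?_
      have := (tendsto_const_nhds (x := f x)).min ENNReal.tendsto_nat_nhds_top
      simpa using this
  have hn : ∀ n : ℕ, (∫⁻ x, min (f x) n ^ (1 - ρ) ∂gaussianReal 0 1) ^ (1 / (1 - ρ)) *
      (∫⁻ x, min (g x) n ^ (1 - ρ) ∂gaussianReal 0 1) ^ (1 / (1 - ρ)) ≤
      ∫⁻ w : ℝ × ℝ, f w.1 * g (ρ * w.1 + √(1 - ρ ^ 2) * w.2)
        ∂(gaussianReal 0 1).prod (gaussianReal 0 1) := by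
    intro n
    have htop : ∀ (f : ℝ → ENNReal) x, min (f x) n ≠ ⊤ := fun f x =>
      ((min_le_right _ _).trans_lt (ENNReal.natCast_lt_top n)).ne
    have hle : ∀ (f : ℝ → ENNReal) x, (min (f x) n).toReal ≤ n := fun f x => by
      simpa using ENNReal.toReal_mono (ENNReal.natCast_ne_top n) (min_le_right (f x) (n : ENNReal))
    have h := le_lintegral_gaussian_corr_of_bounded h0 h1
      (f := fun x => (min (f x) n).toReal) (g := fun x => (min (g x) n).toReal) (M := n)
      (by fun_prop) (fun _ => ENNReal.toReal_nonneg) (hle f)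
      (by fun_prop) (fun _ => ENNReal.toReal_nonneg) (hle g)
    simp only [ENNReal.ofReal_toReal (htop _ _)] at h
    exact h.trans (lintegral_mono fun w => mul_le_mul' (min_le_left _ _) (min_le_left _ _))
  -- A vanishing factor is treated apart because multiplication on `ENNReal` is discontinuous at `0
  -- * ∞`.
  by_cases hf0 : (∫⁻ x, f x ^ (1 - ρ) ∂gaussianReal 0 1) ^ (1 / (1 - ρ)) = 0
  · rw [hf0, zero_mul]; exact zero_le
  by_cases hg0 : (∫⁻ x, g x ^ (1 - ρ) ∂gaussianReal 0 1) ^ (1 / (1 - ρ)) = 0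
  · rw [hg0, mul_zero]; exact zero_le
  exact le_of_tendsto' (ENNReal.Tendsto.mul (hL f hf) (Or.inl hf0) (hL g hg) (Or.inl hg0)) hn

theorem ReverseHypercontractive.map {E F : Type*} [AddCommGroup E] [Module ℝ E]
    [MeasurableSpace E] [AddCommGroup F] [Module ℝ F] [MeasurableSpace F] [MeasurableAdd₂ F]
    [MeasurableConstSMul ℝ F] {ρ c : ℝ} {μ : Measure E} [SFinite μ]
    (h : ReverseHypercontractive ρ c μ) (e : E →ₗ[ℝ] F) (he : Measurable e) :
    ReverseHypercontractive ρ c (μ.map e) := by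
  intro f g hf hg
  have hm : Measurable fun w : F × F => f w.1 * g (ρ • w.1 + c • w.2) := by
    fun_prop
  rw [lintegral_map (by fun_prop) he, lintegral_map (by fun_prop) he,
    lintegral_map hm.lintegral_prod_right' he]
  refine (h (f ∘ e) (g ∘ e) (hf.comp he) (hg.comp he)).trans (le_of_eq ?_)
  refine lintegral_congr fun x => ?_
  have hmx : Measurable fun y => f (e x) * g (ρ • e x + c • y) :=
    hm.comp measurable_prodMk_left
  rw [lintegral_map hmx he]
  simp

/-- The inequality on `E` is applied to the fibrewise norms of `f` and `g`, whose own norms are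
those of `f` and `g`. The product of fibre norms is then bounded by the inequality on `F`. -/
theorem ReverseHypercontractive.prod {E F : Type*} [AddCommGroup E] [Module ℝ E]
    [MeasurableSpace E] [MeasurableAdd₂ E] [MeasurableConstSMul ℝ E] [AddCommGroup F] [Module ℝ F]
    [MeasurableSpace F] [MeasurableAdd₂ F] [MeasurableConstSMul ℝ F] {ρ c : ℝ} (hρ : ρ < 1)
    {μ : Measure E} {ν : Measure F} [SFinite μ] [SFinite ν]
    (hμ : ReverseHypercontractive ρ c μ) (hν : ReverseHypercontractive ρ c ν) :
    ReverseHypercontractive ρ c (μ.prod ν) := by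
  intro f g hf hg
  have hp : 1 - ρ ≠ 0 := by linarith
  have key : ∀ h : E × F → ENNReal, Measurable h →
      ∫⁻ x, ((∫⁻ y, h (x, y) ^ (1 - ρ) ∂ν) ^ (1 / (1 - ρ))) ^ (1 - ρ) ∂μ =
        ∫⁻ w, h w ^ (1 - ρ) ∂μ.prod ν := by
    intro h hh
    rw [lintegral_prod _ (hh.pow_const _).aemeasurable]
    refine lintegral_congr fun x => ?_
    rw [← ENNReal.rpow_mul, one_div_mul_cancel hp, ENNReal.rpow_one]
  have hmeas : ∀ h : E × F → ENNReal, Measurable h →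
      Measurable fun x => (∫⁻ y, h (x, y) ^ (1 - ρ) ∂ν) ^ (1 / (1 - ρ)) := fun h hh =>
    (hh.pow_const _).lintegral_prod_right'.pow_const _
  have h1 := hμ _ _ (hmeas f hf) (hmeas g hg)
  rw [key f hf, key g hg] at h1
  refine h1.trans ?_
  have hm4 : Measurable fun w : (E × F) × (E × F) => f w.1 * g (ρ • w.1 + c • w.2) := by
    have : Measurable fun w : (E × F) × (E × F) =>
      f w.1 * g (ρ • w.1.1 + c • w.2.1, ρ • w.1.2 + c • w.2.2) := by fun_prop
    exact this
  rw [lintegral_prod _ hm4.lintegral_prod_right'.aemeasurable]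
  refine lintegral_mono fun x => ?_
  have e1 : ∀ y, ∫⁻ z, f (x, y) * g (ρ • (x, y) + c • z) ∂μ.prod ν =
      ∫⁻ z₁, ∫⁻ z₂, f (x, y) * g (ρ • x + c • z₁, ρ • y + c • z₂) ∂ν ∂μ := fun y => by
    have hmy : Measurable fun z : E × F => f (x, y) * g (ρ • (x, y) + c • z) :=
      hm4.comp measurable_prodMk_left
    rw [lintegral_prod _ hmy.aemeasurable]
    rfl
  simp_rw [e1]
  have hm3 : Measurable fun w : (F × E) × F =>
      f (x, w.1.1) * g (ρ • x + c • w.1.2, ρ • w.1.1 + c • w.2) := by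
    fun_prop
  -- With `x` and `z₁` outermost, what remains is the inequality on `F` for two fixed fibres.
  rw [lintegral_lintegral_swap (f := fun y z₁ =>
    ∫⁻ z₂, f (x, y) * g (ρ • x + c • z₁, ρ • y + c • z₂) ∂ν)
    hm3.lintegral_prod_right'.aemeasurable]
  refine lintegral_mono fun z => ?_
  exact hν (fun y => f (x, y)) (fun y => g (ρ • x + c • z, y)) (by fun_prop) (by fun_prop)

theorem reverseHypercontractive_pi_gaussianReal {ρ : ℝ} (h0 : 0 ≤ ρ) (h1 : ρ < 1) (d : ℕ) :
    ReverseHypercontractive ρ √(1 - ρ ^ 2) (Measure.pi fun _ : Fin d => gaussianReal 0 1) := by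
  have hp : 1 - ρ ≠ 0 := by linarith
  induction d with
  | zero =>
    intro f g hf hg
    rw [Measure.pi_of_empty _ default]
    have : ∀ x : Fin 0 → ℝ, x = default := fun x => Subsingleton.elim _ _
    simp only [lintegral_dirac, ← ENNReal.rpow_mul, mul_one_div_cancel hp, ENNReal.rpow_one]
    rw [this (ρ • default + _)]
  | succ n ih =>
    have h := ((reverseHypercontractive_gaussianReal h0 h1).prod h1 ih).map
      (Fin.consLinearEquiv ℝ (fun _ : Fin (n + 1) => ℝ)).toLinearMap
      (by
        refine measurable_pi_lambda _ fun i => ?_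
        refine Fin.cases ?_ (fun j => ?_) i
        · simpa using measurable_fst
        · exact (measurable_pi_apply j).comp measurable_snd)
    have h2 := (measurePreserving_piFinSuccAbove (fun _ : Fin (n + 1) => gaussianReal 0 1) 0).symm
    have he : ⇑(Fin.consLinearEquiv ℝ (fun _ : Fin (n + 1) => ℝ)).toLinearMap =
        ⇑(MeasurableEquiv.piFinSuccAbove (fun _ : Fin (n + 1) => ℝ) 0).symm := by
      ext w i
      refine Fin.cases ?_ (fun j => ?_) i <;> simp
    rw [he, h2.map_eq] at h
    exact h

theorem reverseHypercontractive_stdGaussian {ρ : ℝ} (h0 : 0 ≤ ρ) (h1 : ρ < 1) (d : ℕ) :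
    ReverseHypercontractive ρ √(1 - ρ ^ 2) (stdGaussian (EuclideanSpace ℝ (Fin d))) := by
  rw [← map_pi_eq_stdGaussian]
  exact (reverseHypercontractive_pi_gaussianReal h0 h1 d).map
    (WithLp.linearEquiv 2 ℝ (Fin d → ℝ)).symm.toLinearMap (WithLp.measurable_toLp 2 _)

/-! ### From functions to sets, and the theorem. -/

/-- Reverse small-set expansion: sets on which the noise operator applied to an indicator is
small have small measure. -/
theorem ReverseHypercontractive.measure_mul_measure_le {E : Type*} [AddCommGroup E] [Module ℝ E]
    [MeasurableSpace E] [MeasurableAdd₂ E] [MeasurableConstSMul ℝ E] {ρ c : ℝ} (hρ : ρ < 1)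
    {μ : Measure E} [IsProbabilityMeasure μ] (h : ReverseHypercontractive ρ c μ) {A : Set E}
    (hA : MeasurableSet A) (τ : ENNReal) :
    μ {x | μ {z | ρ • x + c • z ∈ A} ≤ τ} * μ A ≤ τ ^ (1 - ρ) := by
  have hp : 0 < 1 - ρ := by linarith
  have hmeas : Measurable fun x => μ {z | ρ • x + c • z ∈ A} :=
    measurable_measure_prodMk_left (s := {w : E × E | ρ • w.1 + c • w.2 ∈ A})
      ((by fun_prop : Measurable fun w : E × E => ρ • w.1 + c • w.2) hA)
  set B := {x | μ {z | ρ • x + c • z ∈ A} ≤ τ} with hB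
  have hBm : MeasurableSet B := measurableSet_le hmeas measurable_const
  have hi : ∀ {S : Set E}, MeasurableSet S →
      ∫⁻ x, (S.indicator (1 : E → ENNReal) x) ^ (1 - ρ) ∂μ = μ S := by
    intro S hS
    rw [← lintegral_indicator_one hS]
    refine lintegral_congr fun x => ?_
    by_cases hx : x ∈ S <;> simp [hx, hp]
  have h2 := h (B.indicator 1) (A.indicator 1) (measurable_one.indicator hBm)
    (measurable_one.indicator hA)
  rw [hi hBm, hi hA, ← ENNReal.mul_rpow_of_nonneg _ _ (by positivity)] at h2
  have h3 : ∫⁻ x, ∫⁻ z, B.indicator (1 : E → ENNReal) x *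
      A.indicator (1 : E → ENNReal) (ρ • x + c • z) ∂μ ∂μ ≤ τ := by
    calc _ ≤ ∫⁻ _ : E, τ ∂μ := lintegral_mono fun x => by
          by_cases hx : x ∈ B
          · simp only [hx, Set.indicator_of_mem, Pi.one_apply, one_mul]
            have hS : MeasurableSet {z | ρ • x + c • z ∈ A} :=
              (by fun_prop : Measurable fun z : E => ρ • x + c • z) hA
            have : ∫⁻ z, A.indicator (1 : E → ENNReal) (ρ • x + c • z) ∂μ =
                μ {z | ρ • x + c • z ∈ A} := by
              rw [← lintegral_indicator_one hS]
              rfl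
            rw [this]
            exact hx
          · simp [hx]
      _ = τ := by simp
  have h4 := ENNReal.rpow_le_rpow (h2.trans h3) hp.le
  rwa [← ENNReal.rpow_mul, one_div_mul_cancel hp.ne', ENNReal.rpow_one] at h4

theorem mainTheorem6 (d : ℕ) {Ω : Type*} [MeasurableSpace Ω] (P : Measure Ω)
    [IsProbabilityMeasure P] (u u' : Ω → EuclideanSpace ℝ (Fin d))
    (hu : HasLaw u (stdGaussian (EuclideanSpace ℝ (Fin d))) P)
    (hu' : HasLaw u' (stdGaussian (EuclideanSpace ℝ (Fin d))) P)
    (huu' : IndepFun u u' P)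
    (ρ : ℝ) (hρ₀ : 0 ≤ ρ) (hρ₁ : ρ ≤ 1)
    (A : Set (EuclideanSpace ℝ (Fin d)))
    (hA : NullMeasurableSet A (stdGaussian (EuclideanSpace ℝ (Fin d))))
    (τ : ℝ) (hτ : 0 < τ) :
    P {ω | P {ω' | ρ • u ω + √(1 - ρ ^ 2) • u' ω' ∈ A} ≤ ENNReal.ofReal τ} ≤
      ENNReal.ofReal (τ ^ (1 - ρ)) / stdGaussian (EuclideanSpace ℝ (Fin d)) A := by
  have hfin := measure_ne_top (stdGaussian (EuclideanSpace ℝ (Fin d))) A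
  -- A nonzero numerator makes the quotient `∞` when `A` is null, so clearing the denominator is
  -- legitimate in that case too.
  have hpos : ENNReal.ofReal (τ ^ (1 - ρ)) ≠ 0 := by
    simpa using Real.rpow_pos_of_pos hτ _
  rw [ENNReal.le_div_iff_mul_le (Or.inr hpos) (Or.inl hfin)]
  -- At `ρ = 1` the exponent `1 / (1 - ρ)` degenerates, but the bound is just `1`.
  rcases hρ₁.eq_or_lt with rfl | hρ
  · simpa using mul_le_mul' (prob_le_one (μ := P) (s := _))
      (prob_le_one (μ := stdGaussian (EuclideanSpace ℝ (Fin d))) (s := A))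
  -- A measurable subset is the right choice: shrinking `A` lowers the inner probability, so the
  -- outer event only grows, while the measure of `A` is unchanged.
  obtain ⟨A₀, hA₀, hA₀m, hA₀e⟩ := hA.exists_measurable_subset_ae_eq
  set γ := stdGaussian (EuclideanSpace ℝ (Fin d)) with hγ
  set c := √(1 - ρ ^ 2) with hc
  have hlaw : ∀ x, P {ω' | ρ • x + c • u' ω' ∈ A₀} = γ {z | ρ • x + c • z ∈ A₀} := fun x => by
    have hS : MeasurableSet {z | ρ • x + c • z ∈ A₀} :=
      (by fun_prop : Measurable fun z : EuclideanSpace ℝ (Fin d) => ρ • x + c • z) hA₀m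
    rw [← hu'.map_eq, Measure.map_apply_of_aemeasurable hu'.aemeasurable hS]
    rfl
  have hBm : MeasurableSet {x | γ {z | ρ • x + c • z ∈ A₀} ≤ ENNReal.ofReal τ} :=
    measurableSet_le (measurable_measure_prodMk_left
      (s := {w : EuclideanSpace ℝ (Fin d) × EuclideanSpace ℝ (Fin d) | ρ • w.1 + c • w.2 ∈ A₀})
      ((by fun_prop : Measurable fun w : EuclideanSpace ℝ (Fin d) × EuclideanSpace ℝ (Fin d) =>
        ρ • w.1 + c • w.2) hA₀m)) measurable_const
  have hle : P {ω | P {ω' | ρ • u ω + c • u' ω' ∈ A} ≤ ENNReal.ofReal τ} ≤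
      γ {x | γ {z | ρ • x + c • z ∈ A₀} ≤ ENNReal.ofReal τ} := by
    have hBu := Measure.map_apply_of_aemeasurable hu.aemeasurable hBm
    rw [hu.map_eq] at hBu
    rw [hBu]
    refine measure_mono fun ω hω => ?_
    have hω₁ : P {ω' | ρ • u ω + c • u' ω' ∈ A} ≤ ENNReal.ofReal τ := hω
    have hω₂ : γ {z | ρ • u ω + c • z ∈ A₀} ≤ ENNReal.ofReal τ := by
      rw [← hlaw]
      exact le_trans (measure_mono fun ω' hω' => hA₀ hω') hω₁
    exact hω₂
  rw [← measure_congr hA₀e, ← ENNReal.ofReal_rpow_of_pos hτ]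
  exact (mul_le_mul_left hle _).trans
    ((reverseHypercontractive_stdGaussian hρ₀ hρ d).measure_mul_measure_le hρ hA₀m _)
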